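/- For $n\ge 0$ let $S_n$ be the set of permutations of $\{1,\dots,n\}$, written as words $\pi=\pi_1\pi_2\cdots\pi_n$. A permutation $\pi\in S_n$ contains a pattern $\tau\in S_k$ if there are indices $i_1<\cdots<i_k$ such that $\pi_{i_1}\cdots\pi_{i_k}$ has the same relative order as $\tau_1\cdots\tau_k$; otherwise $\pi$ avoids $\tau$. For a set $T$ of patterns let $S_n(T)$ be the set of permutations in $S_n$ that avoid every pattern in $T$, and let $F_T(x)=\sum_{n\ge 0}|S_n(T)|\,x^n$. Theorem. Let $T=\{3412,3421,1342\}$. Then, as formal power series, \[ F_T(x)=\frac{2-11x+13x^2-6x^3+(1-x)\,x\,(1-6x+4x^2)\,(1-4x)^{-1/2}}{2\,(1-6x+8x^2-4x^3)}. \] -/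

import Mathlib

/-- The permutation `π`, read as the word `π 0, π 1, …, π (n - 1)`, contains the pattern `τ` (a word
of length `k`): some subsequence of `π` of length `k` has its entries in the same relative order
as the letters of `τ`. -/
def ContainsPattern {k n : ℕ} (τ : Fin k → ℕ) (π : Equiv.Perm (Fin n)) : Prop :=
  ∃ f : Fin k → Fin n, StrictMono f ∧ ∀ i j : Fin k, π (f i) < π (f j) ↔ τ i < τ j

/-- `S_n(T)`: the permutations of size `n` that contain no pattern of the set `T`. -/
def avoiders {k : ℕ} (T : Set (Fin k → ℕ)) (n : ℕ) : Set (Equiv.Perm (Fin n)) :=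
  {π | ∀ τ ∈ T, ¬ ContainsPattern τ π}

/-- The ordinary generating function `F_T(x) = ∑_{n ≥ 0} |S_n(T)| x^n`, as a formal power series. -/
noncomputable def avoidersGF {k : ℕ} (T : Set (Fin k → ℕ)) : PowerSeries ℚ :=
  PowerSeries.mk fun n => ((avoiders T n).ncard : ℚ)

/-- The formal power series `(1 - 4x)^(-1/2)`, that is, the binomial series `(1 + y)^(-1/2)` at
`y = -4x`. -/
noncomputable def invSqrtOneSubFourX : PowerSeries ℚ :=
  PowerSeries.rescale (-4 : ℚ) (PowerSeries.binomialSeries ℚ (-1 / 2 : ℚ))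

/-! Grow avoiders by prepending letters. A first letter of relative value `h` is harmless iff no
letter at least `h` precedes two letters below `h` (`h` as the 3 of 3412 or 3421) and the letters at
least `h` avoid 231 (`h` as the 1 of 1342): `avoidsTriple_prep`.

The series `weight g`, counting avoiders ending in the pattern `g` by added letters, depends only on
the kinds of the values from `2` on and on one of four classes: 231 without the letter 0, 231 only
with 0, no 231 and first letter 0, no 231 and nonzero first letter. Prepending `h ≥ 2` kills the
sites `2, …, h` and keeps the later ones, while `0` or `1` adds one site at the front. So `weight`
satisfies recursions over lists of kinds (`weight_eq`).

These are solved explicitly through `u = catU`, with `u(1 - u) = x`, and they determine all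
coefficients (`coeff_weight`). The one-letter word has no sites from `2` on, so the answer is `1 + x
* weightD []`. -/

section TripleAvoiders

open PowerSeries

/-! ### Square root and Catalan series. -/

lemma invSqrtOneSubFourX_sq : invSqrtOneSubFourX ^ 2 * (1 - 4 * X) = 1 := by
  have h : (PowerSeries.binomialSeries ℚ (-1 / 2 : ℚ)) ^ 2 * (1 + X) = 1 := by
    have h1 : (1 + X : PowerSeries ℚ) = PowerSeries.binomialSeries ℚ (1 : ℚ) := by
      simpa using (PowerSeries.binomialSeries_nat (R := ℚ) (A := ℚ) 1).symm
    rw [h1, sq, ← PowerSeries.binomialSeries_add, ← PowerSeries.binomialSeries_add]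
    norm_num
  have h2 := congrArg (rescale (-4 : ℚ)) h
  simp only [map_mul, map_pow, map_add, map_one, rescale_X] at h2
  have h4 : (C (-4 : ℚ) : PowerSeries ℚ) = -4 := by rw [map_neg, map_ofNat]
  rw [h4] at h2
  rw [invSqrtOneSubFourX]
  linear_combination h2

lemma constantCoeff_invSqrtOneSubFourX : constantCoeff invSqrtOneSubFourX = 1 := by
  rw [← coeff_zero_eq_constantCoeff_apply, invSqrtOneSubFourX, coeff_rescale]
  simp

/-- The inverse `(1 + √(1 - 4x)) / 2` of the generating function of the Catalan numbers. -/
noncomputable def catU : PowerSeries ℚ :=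
  C (1 / 2 : ℚ) * (1 + (1 - 4 * X) * invSqrtOneSubFourX)

lemma two_mul_catU : 2 * catU = 1 + (1 - 4 * X) * invSqrtOneSubFourX := by
  have : (2 : PowerSeries ℚ) * C (1 / 2 : ℚ) = 1 := by
    rw [← map_ofNat (C (R := ℚ)) 2, ← map_mul]; norm_num
  rw [catU, ← mul_assoc, this, one_mul]

lemma inv_sqrt_mul_catU : invSqrtOneSubFourX * (2 * catU - 1) = 1 := by
  linear_combination invSqrtOneSubFourX * two_mul_catU + invSqrtOneSubFourX_sq

lemma catU_mul_one_sub : catU * (1 - catU) = X := by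
  have h4 : (4 : PowerSeries ℚ) ≠ 0 := by
    rw [← map_ofNat (C (R := ℚ)) 4]
    simp
  refine mul_left_cancel₀ h4 ?_
  linear_combination (-(2 * catU) - 1 - (1 - 4 * X) * invSqrtOneSubFourX + 2) * two_mul_catU
    - (1 - 4 * X) * invSqrtOneSubFourX_sq

lemma constantCoeff_catU : constantCoeff catU = 1 := by
  simp [catU, constantCoeff_invSqrtOneSubFourX]
  norm_num

/-- The generating function of the Catalan numbers. -/
noncomputable def catC : PowerSeries ℚ := catU⁻¹

lemma catC_mul : catC * catU = 1 :=
  PowerSeries.inv_mul_cancel _ (by simp [constantCoeff_catU])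

/-- The series `1 / (1 - x)`. -/
noncomputable def geom : PowerSeries ℚ := (1 - X)⁻¹

lemma geom_mul : geom * (1 - X) = 1 :=
  PowerSeries.inv_mul_cancel _ (by simp)

/-- The inverse of the factor of the final denominator which is a unit in `catU`. -/
noncomputable def cubicInv : PowerSeries ℚ := (2 * catU ^ 3 - 4 * catU ^ 2 + 4 * catU - 1)⁻¹

lemma cubicInv_mul : cubicInv * (2 * catU ^ 3 - 4 * catU ^ 2 + 4 * catU - 1) = 1 :=
  PowerSeries.inv_mul_cancel _ (by simp [constantCoeff_catU, map_ofNat]; norm_num)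

/-! ### Closed forms on lists of site kinds. -/

/-- The kinds of values for a new first letter: `dead` stands for a forbidden value, `only` for an
allowed value `h` such that at most the letter `0` is below `h` and preceded by a letter at
least `h`, and `other` for any other allowed value. -/
inductive SiteKind
  | dead
  | only
  | other

open SiteKind

local notation "s" => invSqrtOneSubFourX
local notation "u" => catU

/-- The weight of a permutation in which the letters other than `0` contain `231`. -/
noncomputable def weightI : List SiteKind → PowerSeries ℚ
  | [] => 1
  | dead :: w => weightI w
  | only :: w => geom * weightI w
  | other :: w => geom * weightI w

/-- The weight of a permutation which contains `231`, but only with the letter `0`. -/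
noncomputable def weightA : List SiteKind → PowerSeries ℚ
  | [] => catC
  | dead :: w => weightA w
  | only :: w => catC * weightA w
  | other :: w => weightA w + X * catC * geom * weightI w

/-- These four coefficients solve the linear equations `coeffD₂_eq` to `coeffB₃_eq`; index 2 goes
with `weightA`, index 3 with `weightI`. -/
noncomputable def coeffD₂ : PowerSeries ℚ := (1 - u) ^ 2 * catC * s
noncomputable def coeffB₂ : PowerSeries ℚ := u ^ 2 * (1 - u) * s
noncomputable def coeffD₃ : PowerSeries ℚ := (1 - u) ^ 3 * s * cubicInv
noncomputable def coeffB₃ : PowerSeries ℚ := u * (1 - u) ^ 2 * s * (1 - 2 * X) * cubicInv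

/-- The contribution of the sites above `1` to the weight of a `231`-avoider. -/
noncomputable def weightR : List SiteKind → PowerSeries ℚ
  | [] => 1
  | dead :: w => weightR w
  | only :: w =>
    catC * (weightR w + X * coeffB₂ * catC * weightA w + X * coeffB₃ * geom * weightI w)
  | other :: w => weightR w + X * geom * weightI w

/-- The weight of a `231`-avoider with first letter `0`. -/
noncomputable def weightD (w : List SiteKind) : PowerSeries ℚ :=
  catC ^ 2 * weightR w + coeffD₂ * weightA w + coeffD₃ * weightI w

/-- The weight of a `231`-avoider with nonzero first letter. -/
noncomputable def weightB (w : List SiteKind) : PowerSeries ℚ :=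
  catC * weightR w + coeffB₂ * weightA w + coeffB₃ * weightI w

/-- The sum of the weights of the permutations obtained from the sites in `w`, if a site of kind
`only` gives a permutation of weight `f`. -/
noncomputable def childSum (f : List SiteKind → PowerSeries ℚ) : List SiteKind → PowerSeries ℚ
  | [] => 0
  | dead :: w => childSum f w
  | only :: w => f (only :: w) + childSum f w
  | other :: w => weightI (other :: w) + childSum f w

/-! ### The recursions satisfied by the closed forms. -/

lemma weightI_eq (w : List SiteKind) : weightI w = 1 + X * childSum weightI w := by
  induction w with
  | nil => simp [weightI, childSum]
  | cons a w ih =>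
    cases a
    · simpa [weightI, childSum] using ih
    all_goals
      simp only [weightI, childSum]
      linear_combination ih + weightI w * geom_mul

lemma weightA_eq_aux (w : List SiteKind) : u * weightA w = 1 + X * childSum weightA w := by
  have hx := catU_mul_one_sub
  have hc := catC_mul
  induction w with
  | nil => simpa [weightA, childSum, mul_comm] using hc
  | cons a w ih =>
    cases a
    · simpa [weightA, childSum] using ih
    · simp only [weightA, childSum]
      linear_combination ih + weightA w * hc * u + catC * weightA w * hx
    · simp only [weightA, childSum, weightI]
      linear_combination ih + X * geom * weightI w * hc

lemma weightA_eq (w : List SiteKind) :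
    weightA w = 1 + X * (weightA (only :: w) + childSum weightA w) := by
  have h := weightA_eq_aux w
  simp only [weightA]
  linear_combination h - weightA w * (1 - u) * catC_mul + weightA w * catC * catU_mul_one_sub

lemma weightR_eq (w : List SiteKind) : weightR w = 1 + X * childSum weightB w := by
  have hx := catU_mul_one_sub
  have hc := catC_mul
  induction w with
  | nil => simp [weightR, childSum]
  | cons a w ih =>
    cases a
    · simpa [weightR, childSum] using ih
    · simp only [weightR, weightB, childSum, weightI, weightA]
      -- The value at `only :: w` is `catC * Y`, so the claim reduces to `ih` and the Catalan
      -- equation `C = 1 + x C²`.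
      obtain ⟨Y, hY⟩ : ∃ Y, weightR w + X * coeffB₂ * catC * weightA w
        + X * coeffB₃ * geom * weightI w = Y := ⟨_, rfl⟩
      rw [hY]
      linear_combination ih - hY + Y * catC ^ 2 * hx + Y * (catC * u + 1 - catC) * hc
    · simp only [weightR, childSum, weightI]
      linear_combination ih

lemma X_mul_catC : X * catC = 1 - u := by
  linear_combination (1 - u) * catC_mul - catC * catU_mul_one_sub

lemma X_mul_catC_sq : X * catC ^ 2 = catC - 1 := by
  linear_combination catC * X_mul_catC - catC_mul

/-- This compares the coefficients of `weightA w` in `weightD_eq`; the first summand comes from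
`weightR (only :: w)`. The next three lemmas play the same role. -/
lemma coeffD₂_eq :
    coeffD₂ = X ^ 2 * catC ^ 3 * (catC + 1) * coeffB₂ + X * catC * (coeffD₂ + coeffB₂) := by
  have hc := catC_mul
  simp only [coeffD₂, coeffB₂, ← catU_mul_one_sub]
  linear_combination -(1 - u) ^ 3 * s * (catC + catC * u *
    ((catC * u) ^ 2 + catC * u + 1 + u * (catC * u + 1))) * hc

lemma coeffD₃_eq :
    coeffD₃ = X ^ 2 * catC ^ 2 * (catC + 1) * coeffB₃ * geom + X * (coeffD₃ + coeffB₃) * geom := by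
  have hc := catC_mul
  have hy := geom_mul
  simp only [coeffD₃, coeffB₃]
  rw [← catU_mul_one_sub] at hy ⊢
  linear_combination -s * cubicInv * (1 - u) ^ 4 * (1 - 2 * (u * (1 - u))) * geom *
    ((catC * u) ^ 2 + catC * u + 1 + u * (catC * u) + u) * hc - s * cubicInv * (1 - u) ^ 3 * hy

lemma coeffB₂_eq : coeffB₂ = X * coeffD₂ + X * catC := by
  have hc := catC_mul
  have hs := inv_sqrt_mul_catU
  simp only [coeffD₂, coeffB₂, ← catU_mul_one_sub]
  linear_combination -(1 - u) * ((1 - u) ^ 2 * s + 1) * hc + (1 - u) * hs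

lemma coeffB₃_eq :
    coeffB₃ = X * (catC ^ 2 * X + coeffD₂ * X * catC + coeffD₃) * geom := by
  have hc := catC_mul
  have hs := inv_sqrt_mul_catU
  have hy := geom_mul
  simp only [coeffD₂, coeffD₃, coeffB₃]
  rw [← catU_mul_one_sub] at hy ⊢
  linear_combination u * (1 - u) ^ 2 * (-geom * s * u * (catC * u + 1) * hc
    + geom * catC ^ 2 * u * hs - s * (1 - 2 * (u * (1 - u))) * cubicInv * hy
    + geom * s * u * cubicInv_mul)

lemma weightD_eq (w : List SiteKind) :
    weightD w = 1 + X * (weightD (only :: w) + weightB (only :: w) + childSum weightB w) := by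
  simp only [weightD, weightB, weightR, weightA, weightI]
  linear_combination weightR_eq w - (catC + 1) * weightR w * X_mul_catC_sq
    + weightA w * coeffD₂_eq + weightI w * coeffD₃_eq

lemma weightB_eq (w : List SiteKind) :
    weightB w = 1 + X * (weightD (other :: w) + weightA (only :: w) + childSum weightB w) := by
  simp only [weightD, weightB, weightR, weightA, weightI]
  linear_combination weightR_eq w - weightR w * X_mul_catC_sq
    + weightA w * coeffB₂_eq + weightI w * coeffB₃_eq

lemma one_add_X_mul_weightD_nil :
    (1 + X * weightD []) * (2 * (1 - 6 * X + 8 * X ^ 2 - 4 * X ^ 3)) =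
      2 - 11 * X + 13 * X ^ 2 - 6 * X ^ 3 + (1 - X) * X * (1 - 6 * X + 4 * X ^ 2) * s := by
  have hc := catC_mul
  have hs := inv_sqrt_mul_catU
  have h : X * weightD [] = X * s + u * (1 - u) ^ 4 * s * cubicInv := by
    simp only [weightD, weightR, weightA, weightI, coeffD₂, coeffD₃, ← catU_mul_one_sub]
    linear_combination (1 - u) * u * s * (catC * u + 1) * hc - (1 - u) * catC ^ 2 * u * hs
  rw [h, ← catU_mul_one_sub]
  -- With `p(u) = 2u³ - 4u² + 4u - 1` and `x = u(1 - u)`, the cubic `1 - 6x + 8x² - 4x³` equals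
  -- `-p(u) p(1 - u)`; `cubicInv` cancels `p(u)`.
  linear_combination -2 * u * (1 - u) ^ 4 * s *
    (2 * (1 - u) ^ 3 - 4 * (1 - u) ^ 2 + 4 * (1 - u) - 1) * cubicInv_mul
    - (2 * (1 - 6 * (u * (1 - u)) + 8 * (u * (1 - u)) ^ 2 - 4 * (u * (1 - u)) ^ 3)
      - (2 - 11 * (u * (1 - u)) + 13 * (u * (1 - u)) ^ 2 - 6 * (u * (1 - u)) ^ 3)) * hs

/-! ### Prepending a letter to a word. -/

/-- The value of the letter `x` after a letter `h` has been put in front of a permutation. -/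
def bump (h x : ℕ) : ℕ := if x < h then x else x + 1

lemma bump_lt_bump {h x y : ℕ} : bump h x < bump h y ↔ x < y := by
  unfold bump; split_ifs <;> omega

lemma bump_lt_self {h x : ℕ} : bump h x < h ↔ x < h := by
  unfold bump; split_ifs <;> omega

lemma self_lt_bump {h x : ℕ} : h < bump h x ↔ h ≤ x := by
  unfold bump; split_ifs <;> omega

lemma succ_le_bump {h k x : ℕ} (hk : h ≤ k) : k + 1 ≤ bump h x ↔ k ≤ x := by
  unfold bump; split_ifs <;> omega

lemma bump_lt_succ {h k x : ℕ} (hk : h ≤ k) : bump h x < k + 1 ↔ x < k := by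
  unfold bump; split_ifs <;> omega

lemma one_le_bump {h x : ℕ} (hh : 1 ≤ h) : 1 ≤ bump h x ↔ 1 ≤ x := by
  unfold bump; split_ifs <;> omega

lemma bump_eq_zero {h x : ℕ} (hh : 1 ≤ h) : bump h x = 0 ↔ x = 0 := by
  unfold bump; grind

lemma bump_injective (h : ℕ) : Function.Injective (bump h) := by
  intro x y hxy
  unfold bump at hxy
  split_ifs at hxy <;> omega

lemma bump_ne_self (h x : ℕ) : bump h x ≠ h := by
  unfold bump; split_ifs <;> omega

/-- The word obtained from `g` by putting a letter of relative value `h` in front. -/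
def prep (h : ℕ) {n : ℕ} (g : Fin n → ℕ) : Fin (n + 1) → ℕ := Fin.cons h fun i => bump h (g i)

@[simp] lemma prep_zero (h : ℕ) {n : ℕ} (g : Fin n → ℕ) : prep h g 0 = h := rfl

@[simp] lemma prep_succ (h : ℕ) {n : ℕ} (g : Fin n → ℕ) (i : Fin n) :
    prep h g i.succ = bump h (g i) := rfl

/-- `g` is the word of a permutation of `{0, …, n - 1}`. -/
structure IsPermWord {n : ℕ} (g : Fin n → ℕ) : Prop where
  inj : Function.Injective g
  lt : ∀ i, g i < n

lemma IsPermWord.isPermWord_prep {n h : ℕ} {g : Fin n → ℕ} (hg : IsPermWord g) (hh : h ≤ n) :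
    IsPermWord (prep h g) where
  inj := by
    rw [prep, Fin.cons_injective_iff]
    refine ⟨?_, (bump_injective h).comp hg.inj⟩
    rintro ⟨i, hi⟩
    exact bump_ne_self _ _ hi
  lt := by
    intro i
    refine Fin.cases ?_ (fun i => ?_) i
    · simp; omega
    · have := hg.lt i
      simp only [prep_succ, bump]
      split_ifs <;> omega

lemma IsPermWord.exists_eq {n v : ℕ} {g : Fin n → ℕ} (hg : IsPermWord g) (hv : v < n) :
    ∃ i, g i = v := by
  have hinj : Function.Injective fun i => (⟨g i, hg.lt i⟩ : Fin n) := fun i j hij =>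
    hg.inj (Fin.mk.inj_iff.1 hij)
  obtain ⟨i, hi⟩ := (Finite.injective_iff_surjective.1 hinj) ⟨v, hv⟩
  exact ⟨i, Fin.mk.inj_iff.1 hi⟩

/-- Avoidance of `3412`, `3421` and `1342`. -/
def AvoidsTriple {n : ℕ} (g : Fin n → ℕ) : Prop :=
  ∀ i j k l, i < j → j < k → k < l →
    ¬ (g k < g i ∧ g l < g i ∧ g i < g j) ∧ ¬ (g i < g l ∧ g l < g j ∧ g j < g k)

/-- No letter which is at least `h` precedes two letters below `h`. -/
def AtMostOneBelow {n : ℕ} (g : Fin n → ℕ) (h : ℕ) : Prop :=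
  ∀ j k l, j < k → k < l → ¬ (h ≤ g j ∧ g k < h ∧ g l < h)

/-- The letters which are at least `h` avoid the pattern `231`. -/
def Avoids231From {n : ℕ} (g : Fin n → ℕ) (h : ℕ) : Prop :=
  ∀ j k l, j < k → k < l → ¬ (h ≤ g l ∧ g l < g j ∧ g j < g k)

/-- A letter of relative value `h` may be put in front of `g`. -/
def IsSite {n : ℕ} (g : Fin n → ℕ) (h : ℕ) : Prop :=
  AtMostOneBelow g h ∧ Avoids231From g h

/-- No nonzero letter below `h` is preceded by a letter which is at least `h`. -/
def OnlyZeroBelow {n : ℕ} (g : Fin n → ℕ) (h : ℕ) : Prop :=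
  ∀ j k, j < k → h ≤ g j → g k < h → g k = 0

/-- No letter below `h` is preceded by a letter which is at least `h`. -/
def NoneBelow {n : ℕ} (g : Fin n → ℕ) (h : ℕ) : Prop :=
  ∀ j k, j < k → ¬ (h ≤ g j ∧ g k < h)

section Prep

variable {n : ℕ} {g : Fin n → ℕ} {h k : ℕ}

lemma avoidsTriple_prep : AvoidsTriple (prep h g) ↔ AvoidsTriple g ∧ IsSite g h := by
  simp only [AvoidsTriple, IsSite, AtMostOneBelow, Avoids231From, Fin.forall_fin_succ,
    prep_zero, prep_succ, bump_lt_bump, bump_lt_self, self_lt_bump, Fin.succ_lt_succ_iff,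
    Fin.not_lt_zero, Fin.succ_pos, false_imp_iff, true_imp_iff, implies_true,
    true_and]
  constructor
  · rintro ⟨h1, h2⟩
    refine ⟨h2, fun j k l hj hk => ?_, fun j k l hj hk => ?_⟩ <;>
    · have := h1 j k l hj hk
      tauto
  · rintro ⟨h1, h2, h3⟩
    refine ⟨fun j k l hj hk => ?_, h1⟩
    have := h2 j k l hj hk
    have := h3 j k l hj hk
    tauto

lemma avoids231From_prep {c : ℕ} : Avoids231From (prep h g) c ↔
    (∀ k l, k < l → ¬ (c ≤ bump h (g l) ∧ g l < h ∧ h ≤ g k)) ∧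
    ∀ j k l, j < k → k < l → ¬ (c ≤ bump h (g l) ∧ g l < g j ∧ g j < g k) := by
  simp only [Avoids231From, Fin.forall_fin_succ,
    prep_zero, prep_succ, bump_lt_bump, bump_lt_self, self_lt_bump, Fin.succ_lt_succ_iff,
    Fin.not_lt_zero, Fin.succ_pos, false_imp_iff, true_imp_iff, implies_true,
    true_and]

lemma avoids231From_prep_zero :
    Avoids231From (prep h g) 0 ↔ Avoids231From g 0 ∧ NoneBelow g h := by
  rw [avoids231From_prep]
  simp only [Avoids231From, NoneBelow, Nat.zero_le, true_and]
  tauto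

lemma avoids231From_prep_one (hh : 1 ≤ h) :
    Avoids231From (prep h g) 1 ↔ Avoids231From g 1 ∧ OnlyZeroBelow g h := by
  rw [avoids231From_prep]
  simp only [Avoids231From, OnlyZeroBelow, one_le_bump hh, Nat.one_le_iff_ne_zero]
  refine ⟨fun ⟨h1, h2⟩ => ⟨h2, fun j k hjk h3 h4 => ?_⟩,
    fun ⟨h1, h2⟩ => ⟨fun k l hkl ⟨h3, h4, h5⟩ => h3 (h2 k l hkl h5 h4), h1⟩⟩
  by_contra h5
  exact h1 j k hjk ⟨h5, h4, h3⟩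

lemma atMostOneBelow_prep_succ (hk : h ≤ k) :
    AtMostOneBelow (prep h g) (k + 1) ↔ AtMostOneBelow g k := by
  have : ¬ k + 1 ≤ h := by omega
  simp only [AtMostOneBelow, Fin.forall_fin_succ, this,
    prep_zero, prep_succ, succ_le_bump hk, bump_lt_succ hk, Fin.succ_lt_succ_iff,
    Fin.not_lt_zero, Fin.succ_pos, false_imp_iff, true_imp_iff, implies_true,
    true_and, false_and, not_false_eq_true]

lemma avoids231From_prep_succ (hk : h ≤ k) :
    Avoids231From (prep h g) (k + 1) ↔ Avoids231From g k := by
  rw [avoids231From_prep]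
  simp only [Avoids231From, succ_le_bump hk]
  refine and_iff_right fun k l _ => ?_
  omega

lemma isSite_prep_succ (hk : h ≤ k) : IsSite (prep h g) (k + 1) ↔ IsSite g k :=
  and_congr (atMostOneBelow_prep_succ hk) (avoids231From_prep_succ hk)

lemma onlyZeroBelow_prep_succ (hh : 1 ≤ h) (hk : h ≤ k) :
    OnlyZeroBelow (prep h g) (k + 1) ↔ OnlyZeroBelow g k := by
  have : ¬ k + 1 ≤ h := by omega
  simp only [OnlyZeroBelow, Fin.forall_fin_succ, this,
    prep_zero, prep_succ, succ_le_bump hk, bump_lt_succ hk, bump_eq_zero hh, Fin.succ_lt_succ_iff,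
    Fin.not_lt_zero, Fin.succ_pos, false_imp_iff, implies_true,
    true_and]

/-- The old 0 becomes 1 and loses its exemption, while the new 0 comes first and is preceded by
nothing. -/
lemma onlyZeroBelow_prep_zero_succ : OnlyZeroBelow (prep 0 g) (k + 1) ↔ NoneBelow g k := by
  simp only [OnlyZeroBelow, NoneBelow, Fin.forall_fin_succ, bump,
    prep_zero, prep_succ, Fin.succ_lt_succ_iff, Nat.not_lt_zero, if_false,
    Fin.not_lt_zero, Fin.succ_pos, false_imp_iff, implies_true,
    true_and, add_le_add_iff_right, add_lt_add_iff_right,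
    Nat.le_zero, Nat.succ_ne_zero, imp_false, not_and]

/-- The new first letter precedes both 0 and 1. -/
lemma IsPermWord.not_atMostOneBelow_prep (hg : IsPermWord g) (hk : 2 ≤ k) (hkh : k ≤ h)
    (hh : h ≤ n) : ¬ AtMostOneBelow (prep h g) k := by
  obtain ⟨i, hi⟩ := hg.exists_eq (v := 0) (by omega)
  obtain ⟨j, hj⟩ := hg.exists_eq (v := 1) (by omega)
  have hij : i ≠ j := by rintro rfl; omega
  have hi' : bump h (g i) < k := by rw [hi, bump, if_pos] <;> omega
  have hj' : bump h (g j) < k := by rw [hj, bump, if_pos] <;> omega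
  intro H
  rcases lt_or_gt_of_ne hij with hlt | hlt
  · exact H 0 i.succ j.succ (Fin.succ_pos _) (Fin.succ_lt_succ_iff.2 hlt) ⟨hkh, hi', hj'⟩
  · exact H 0 j.succ i.succ (Fin.succ_pos _) (Fin.succ_lt_succ_iff.2 hlt) ⟨hkh, hj', hi'⟩

lemma Avoids231From.mono {c d : ℕ} (hB : Avoids231From g c) (hcd : c ≤ d) : Avoids231From g d :=
  fun j k l hj hk ⟨h1, h2⟩ => hB j k l hj hk ⟨hcd.trans h1, h2⟩

lemma noneBelow_zero : NoneBelow g 0 := fun _ _ _ h => Nat.not_lt_zero _ h.2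

lemma onlyZeroBelow_one : OnlyZeroBelow g 1 := fun _ _ _ _ h => Nat.lt_one_iff.1 h

lemma NoneBelow.onlyZeroBelow (hF : NoneBelow g h) : OnlyZeroBelow g h :=
  fun j k hj h1 h2 => (hF j k hj ⟨h1, h2⟩).elim

lemma atMostOneBelow_zero : AtMostOneBelow g 0 := fun _ _ _ _ _ h => Nat.not_lt_zero _ h.2.1

lemma IsPermWord.atMostOneBelow_one (hg : IsPermWord g) : AtMostOneBelow g 1 := by
  intro j k l _ hkl h
  have := hg.inj (a₁ := k) (a₂ := l) (by omega)
  exact hkl.ne this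

lemma IsPermWord.noneBelow_of_onlyZeroBelow (hg : IsPermWord g) (hB : Avoids231From g 0)
    (hh : 2 ≤ h) (hG : OnlyZeroBelow g h) : NoneBelow g h := by
  rintro j k hjk ⟨h1, h2⟩
  have hk := hG j k hjk h1 h2
  obtain ⟨i, hi⟩ := hg.exists_eq (v := 1) (by have := hg.lt j; omega)
  rcases lt_trichotomy i j with hij | rfl | hij
  -- The letters 1, `g j`, 0 form 231.
  · exact hB i j k hij hjk ⟨Nat.zero_le _, by omega, by omega⟩
  · omega
  · have := hG j i hij h1 (by omega)
    omega

end Prep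

lemma IsPermWord.noneBelow_one_iff {n : ℕ} {g : Fin (n + 1) → ℕ} (hg : IsPermWord g) :
    NoneBelow g 1 ↔ g 0 = 0 := by
  constructor
  · intro hF
    obtain ⟨i, hi⟩ := hg.exists_eq (v := 0) (by omega)
    by_contra h0
    refine hF 0 i (Fin.pos_iff_ne_zero.2 ?_) ⟨by omega, by omega⟩
    rintro rfl
    exact h0 hi
  · rintro h0 j k hjk ⟨-, h2⟩
    have := hg.inj (a₁ := k) (a₂ := 0) (by omega)
    subst this
    exact absurd hjk (Fin.not_lt_zero _)

/-! ### How the list of site kinds changes. -/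

open Classical in
/-- The kind of the value `h` for a new first letter of `g`. -/
noncomputable def siteKind {n : ℕ} (g : Fin n → ℕ) (h : ℕ) : SiteKind :=
  if IsSite g h then (if OnlyZeroBelow g h then only else other) else dead

/-- The kinds of the values from `2` on for a new first letter of `g`. -/
noncomputable def kinds {m : ℕ} (g : Fin (m + 1) → ℕ) : List SiteKind :=
  (List.range m).map fun i => siteKind g (i + 2)

section Kinds

variable {m : ℕ} {g : Fin (m + 1) → ℕ}

lemma drop_kinds {i : ℕ} (hi : i < m) :
    (kinds g).drop i = siteKind g (i + 2) :: (kinds g).drop (i + 1) := by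
  rw [List.drop_eq_getElem_cons (by simpa [kinds] using hi)]
  simp [kinds]

lemma siteKind_prep_succ {h k : ℕ} (hh : 1 ≤ h) (hk : h ≤ k) :
    siteKind (prep h g) (k + 1) = siteKind g k := by
  classical
  simp only [siteKind, isSite_prep_succ hk, onlyZeroBelow_prep_succ hh hk]

lemma IsPermWord.kinds_prep_add_two (hg : IsPermWord g) {i : ℕ} (hi : i < m) :
    kinds (prep (i + 2) g) = List.replicate (i + 1) dead ++ (kinds g).drop i := by
  refine List.ext_getElem (by simp [kinds]; omega) fun j h1 h2 => ?_
  rw [List.getElem_append]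
  simp only [kinds, List.getElem_map, List.getElem_range, List.length_replicate,
    List.getElem_replicate, List.getElem_drop]
  split_ifs with hj
  · have := hg.not_atMostOneBelow_prep (k := j + 2) (h := i + 2) (by omega) (by omega) (by omega)
    simp [siteKind, IsSite, this]
  · rw [siteKind_prep_succ (by omega) (by omega)]
    congr 1
    omega

lemma IsPermWord.siteKind_one (hg : IsPermWord g) (hB : Avoids231From g 1) :
    siteKind g 1 = only := by
  simp [siteKind, IsSite, hg.atMostOneBelow_one, hB, onlyZeroBelow_one]

lemma kinds_prep_one : kinds (prep 1 g) = siteKind g 1 :: kinds g := by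
  simp only [kinds, List.range_succ_eq_map, List.map_cons, List.map_map]
  congr 1
  · exact siteKind_prep_succ le_rfl le_rfl
  · refine List.map_congr_left fun i _ => ?_
    exact siteKind_prep_succ (by omega) (by omega)

open Classical in
lemma IsPermWord.kinds_prep_zero (hg : IsPermWord g) (hB : Avoids231From g 0) :
    kinds (prep 0 g) = (if g 0 = 0 then only else other) :: kinds g := by
  simp only [kinds, List.range_succ_eq_map, List.map_cons, List.map_map]
  congr 1
  · simp only [siteKind, isSite_prep_succ (Nat.zero_le 1), onlyZeroBelow_prep_zero_succ,
      hg.noneBelow_one_iff]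
    rw [if_pos ⟨hg.atMostOneBelow_one, hB.mono (Nat.zero_le _)⟩]
  · refine List.map_congr_left fun i _ => ?_
    have : NoneBelow g (i + 2) ↔ OnlyZeroBelow g (i + 2) :=
      ⟨fun h => h.onlyZeroBelow, hg.noneBelow_of_onlyZeroBelow hB (by omega)⟩
    simp only [Function.comp, siteKind, isSite_prep_succ (Nat.zero_le _),
      onlyZeroBelow_prep_zero_succ, this]

end Kinds

/-! ### Weights of words and their recursion. -/

lemma weightI_replicate (k : ℕ) (w : List SiteKind) :
    weightI (List.replicate k dead ++ w) = weightI w := by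
  induction k with
  | zero => rfl
  | succ k ih => simpa [List.replicate_succ, weightI] using ih

lemma weightA_replicate (k : ℕ) (w : List SiteKind) :
    weightA (List.replicate k dead ++ w) = weightA w := by
  induction k with
  | zero => rfl
  | succ k ih => simpa [List.replicate_succ, weightA] using ih

lemma weightR_replicate (k : ℕ) (w : List SiteKind) :
    weightR (List.replicate k dead ++ w) = weightR w := by
  induction k with
  | zero => rfl
  | succ k ih => simpa [List.replicate_succ, weightR] using ih

lemma weightB_replicate (k : ℕ) (w : List SiteKind) :
    weightB (List.replicate k dead ++ w) = weightB w := by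
  simp only [weightB, weightI_replicate, weightA_replicate, weightR_replicate]

/-- The contribution to `childSum` of the first element of a list. -/
noncomputable def childTerm (f : List SiteKind → PowerSeries ℚ) : List SiteKind → PowerSeries ℚ
  | [] => 0
  | dead :: _ => 0
  | only :: w => f (only :: w)
  | other :: w => weightI (other :: w)

lemma childSum_eq_sum (f : List SiteKind → PowerSeries ℚ) (w : List SiteKind) :
    childSum f w = ∑ i ∈ Finset.range w.length, childTerm f (w.drop i) := by
  induction w with
  | nil => rfl
  | cons a w ih =>
    rw [List.length_cons, Finset.sum_range_succ']
    simp only [List.drop_succ_cons, List.drop_zero, ← ih]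
    cases a <;> simp [childSum, childTerm, add_comm]

open Classical in
/-- The generating function of the avoiders which end in a pattern-avoiding permutation `g`. -/
noncomputable def weight {m : ℕ} (g : Fin (m + 1) → ℕ) : PowerSeries ℚ :=
  if Avoids231From g 0 then (if g 0 = 0 then weightD (kinds g) else weightB (kinds g))
  else if Avoids231From g 1 then weightA (kinds g) else weightI (kinds g)

section Weight

variable {m : ℕ} {g : Fin (m + 1) → ℕ}

open Classical in
/-- The weight of the word obtained by putting a letter `h` in front of `g`, if that is allowed. -/
noncomputable def siteWeight (g : Fin (m + 1) → ℕ) (h : ℕ) : PowerSeries ℚ :=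
  if IsSite g h then weight (prep h g) else 0

lemma sum_siteWeight (f : List SiteKind → PowerSeries ℚ)
    (hf : ∀ i < m, siteWeight g (i + 2) = childTerm f ((kinds g).drop i)) :
    ∑ h ∈ Finset.range (m + 2), siteWeight g h =
      childSum f (kinds g) + siteWeight g 1 + siteWeight g 0 := by
  rw [Finset.sum_range_succ', Finset.sum_range_succ', childSum_eq_sum]
  congr 2
  refine Finset.sum_congr (by simp [kinds]) fun i hi => hf i ?_
  simpa [kinds] using hi

/-- At a site of kind `other`, the new letter plays the 2 of a 231 whose 1 is nonzero, so the class
becomes that of `weightI` whatever it was; only sites of kind `only` need `hf`. -/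
lemma siteWeight_eq_childTerm (hg : IsPermWord g) (f : List SiteKind → PowerSeries ℚ)
    (hf : ∀ i < m, OnlyZeroBelow g (i + 2) → weight (prep (i + 2) g) = f ((kinds g).drop i))
    (i : ℕ) (hi : i < m) : siteWeight g (i + 2) = childTerm f ((kinds g).drop i) := by
  classical
  by_cases hs : IsSite g (i + 2)
  · by_cases hG : OnlyZeroBelow g (i + 2)
    · rw [siteWeight, if_pos hs, hf i hi hG, drop_kinds hi]
      simp [siteKind, hs, hG, childTerm]
    · have h1 : ¬ Avoids231From (prep (i + 2) g) 1 := fun h =>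
        hG ((avoids231From_prep_one (by omega)).1 h).2
      rw [siteWeight, if_pos hs, weight, if_neg fun h => h1 (h.mono (Nat.zero_le _)), if_neg h1,
        hg.kinds_prep_add_two hi, weightI_replicate, drop_kinds hi]
      simp [siteKind, hs, hG, childTerm]
  · rw [siteWeight, if_neg hs, drop_kinds hi]
    simp [siteKind, hs, childTerm]

lemma weight_eq (hg : IsPermWord g) :
    weight g = 1 + X * ∑ h ∈ Finset.range (m + 2), siteWeight g h := by
  classical
  by_cases h1 : Avoids231From g 1
  swap
  · have h0 : ¬ Avoids231From g 0 := fun h => h1 (h.mono (Nat.zero_le _))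
    rw [sum_siteWeight weightI (siteWeight_eq_childTerm hg _ fun i hi _ => ?_), weight, if_neg h0,
      if_neg h1, siteWeight, if_neg fun h => h1 h.2, siteWeight, if_neg fun h => h0 h.2, add_zero,
      add_zero]
    · exact weightI_eq _
    · have h2 : ¬ Avoids231From (prep (i + 2) g) 1 := fun h =>
        h1 ((avoids231From_prep_one (by omega)).1 h).1
      rw [weight, if_neg fun h => h2 (h.mono (Nat.zero_le _)), if_neg h2,
        hg.kinds_prep_add_two hi, weightI_replicate]
  have hs1 : IsSite g 1 := ⟨hg.atMostOneBelow_one, h1⟩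
  have hk1 : kinds (prep 1 g) = only :: kinds g := by rw [kinds_prep_one, hg.siteKind_one h1]
  have h11 : Avoids231From (prep 1 g) 1 :=
    (avoids231From_prep_one le_rfl).2 ⟨h1, onlyZeroBelow_one⟩
  by_cases h0 : Avoids231From g 0
  swap
  · have h2 (h : ℕ) : ¬ Avoids231From (prep h g) 0 := fun h =>
      h0 (avoids231From_prep_zero.1 h).1
    rw [sum_siteWeight weightA (siteWeight_eq_childTerm hg _ fun i hi hG => ?_), weight, if_neg h0,
      if_pos h1, siteWeight, if_pos hs1, siteWeight, if_neg fun h => h0 h.2, add_zero,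
      weight, if_neg (h2 1), if_pos h11, hk1, add_comm (childSum _ _)]
    · exact weightA_eq _
    · rw [weight, if_neg (h2 _), if_pos ((avoids231From_prep_one (by omega)).2 ⟨h1, hG⟩),
        hg.kinds_prep_add_two hi, weightA_replicate]
  have hs0 : IsSite g 0 := ⟨atMostOneBelow_zero, h0⟩
  have h00 : Avoids231From (prep 0 g) 0 := avoids231From_prep_zero.2 ⟨h0, noneBelow_zero⟩
  rw [sum_siteWeight weightB (siteWeight_eq_childTerm hg _ fun i hi hG => ?_), weight, if_pos h0,
    siteWeight, if_pos hs1, siteWeight, if_pos hs0, weight, hk1, weight, if_pos h00, prep_zero 0,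
    if_pos (rfl : (0 : ℕ) = 0), hg.kinds_prep_zero h0]
  · by_cases hz : g 0 = 0
    · rw [if_pos hz, if_pos hz,
        if_pos (avoids231From_prep_zero.2 ⟨h0, hg.noneBelow_one_iff.2 hz⟩), prep_zero,
        if_neg one_ne_zero, weightD_eq]
      ring
    -- A nonzero first letter precedes 0, so prepending 1 creates a 231 ending in 0.
    · rw [if_neg hz, if_neg hz, if_pos h11,
        if_neg fun h => hz (hg.noneBelow_one_iff.1 (avoids231From_prep_zero.1 h).2), weightB_eq]
      ring
  · rw [weight, if_pos (avoids231From_prep_zero.2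
      ⟨h0, hg.noneBelow_of_onlyZeroBelow h0 (by omega) hG⟩), prep_zero, if_neg (by omega),
      hg.kinds_prep_add_two hi, weightB_replicate]

end Weight

/-! ### From weights to counting permutations. -/

open Classical in
/-- The number of avoiders obtained from `g` by putting `d` letters in front. -/
noncomputable def descendants : ℕ → ∀ {n : ℕ}, (Fin n → ℕ) → ℕ
  | 0, _, _ => 1
  | d + 1, n, g => ∑ h ∈ Finset.range (n + 1), if IsSite g h then descendants d (prep h g) else 0

lemma coeff_weight (d : ℕ) {m : ℕ} {g : Fin (m + 1) → ℕ} (hg : IsPermWord g) :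
    coeff d (weight g) = descendants d g := by
  classical
  induction d generalizing m with
  | zero => rw [weight_eq hg]; simp [descendants]
  | succ d ih =>
    rw [weight_eq hg, map_add, coeff_succ_X_mul, descendants, map_sum]
    simp only [coeff_one, Nat.succ_ne_zero, if_false, zero_add, Nat.cast_sum]
    refine Finset.sum_congr rfl fun h hh => ?_
    rw [siteWeight]
    split_ifs
    · exact ih (hg.isPermWord_prep (by simpa [Nat.lt_succ_iff] using hh))
    · simp

/-- The permutation obtained from `σ` by putting the value `h` in front. -/
noncomputable def consPerm {n : ℕ} (h : Fin (n + 1)) (σ : Equiv.Perm (Fin n)) :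
    Equiv.Perm (Fin (n + 1)) :=
  Equiv.ofBijective (Fin.cons h fun i => h.succAbove (σ i)) <| by
    rw [← Finite.injective_iff_bijective, Fin.cons_injective_iff]
    exact ⟨fun ⟨i, hi⟩ => Fin.succAbove_ne _ _ hi,
      Fin.succAbove_right_injective.comp σ.injective⟩

/-- The word of a permutation. -/
def permWord {n : ℕ} (σ : Equiv.Perm (Fin n)) (i : Fin n) : ℕ := σ i

lemma permWord_consPerm {n : ℕ} (h : Fin (n + 1)) (σ : Equiv.Perm (Fin n)) :
    permWord (consPerm h σ) = prep h (permWord σ) := by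
  funext i
  refine Fin.cases rfl (fun i => ?_) i
  simp only [permWord, consPerm, Equiv.ofBijective_apply, Fin.cons_succ, prep_succ, bump,
    Fin.succAbove, Fin.lt_def, Fin.val_castSucc]
  split_ifs <;> simp [*]

lemma consPerm_bijective (n : ℕ) : Function.Bijective
    fun p : Equiv.Perm (Fin n) × Fin (n + 1) => consPerm p.2 p.1 := by
  rw [Fintype.bijective_iff_injective_and_card]
  constructor
  · rintro ⟨σ, h⟩ ⟨τ, k⟩ hp
    have hp' : ∀ i, consPerm h σ i = consPerm k τ i := fun i => congrArg (fun π => π i) hp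
    have h0 : h = k := hp' 0
    subst h0
    congr 1
    ext i
    exact congrArg Fin.val (Fin.succAbove_right_injective (p := h) (hp' i.succ))
  · simp [Fintype.card_perm, Nat.factorial_succ, mul_comm]

open Classical in
lemma sum_descendants (d n : ℕ) :
    (∑ σ : Equiv.Perm (Fin n), if AvoidsTriple (permWord σ) then descendants d (permWord σ) else 0) =
      ∑ σ : Equiv.Perm (Fin (n + d)), if AvoidsTriple (permWord σ) then 1 else 0 := by
  induction d generalizing n with
  | zero => rfl
  | succ d ih =>
    rw [show n + (d + 1) = n + 1 + d by omega, ← ih (n + 1),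
      ← (consPerm_bijective n).sum_comp, Fintype.sum_prod_type]
    refine Finset.sum_congr rfl fun σ _ => ?_
    simp only [permWord_consPerm, avoidsTriple_prep, descendants, Finset.sum_range]
    split_ifs with hσ <;> simp [hσ]

lemma containsPattern_of_lt {n : ℕ} (τ : Fin 4 → ℕ) (π : Equiv.Perm (Fin n)) {i j k l : Fin n}
    (hij : i < j) (hjk : j < k) (hkl : k < l)
    (h : ∀ a b : Fin 4, π (![i, j, k, l] a) < π (![i, j, k, l] b) ↔ τ a < τ b) :
    ContainsPattern τ π := by
  refine ⟨![i, j, k, l], ?_, h⟩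
  rw [Fin.strictMono_iff_lt_succ]
  intro a
  fin_cases a <;> assumption

/-- `AvoidsTriple` leaves the order of the last two letters open, which merges 3412 and 3421. -/
lemma avoiders_eq (n : ℕ) :
    avoiders {![3, 4, 1, 2], ![3, 4, 2, 1], ![1, 3, 4, 2]} n =
      {π : Equiv.Perm (Fin n) | AvoidsTriple (permWord π)} := by
  ext π
  simp only [avoiders, Set.mem_ofPred_eq, Set.mem_insert_iff, Set.mem_singleton_iff,
    forall_eq_or_imp, forall_eq]
  constructor
  · rintro ⟨h1, h2, h3⟩ i j k l hij hjk hkl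
    have hne : π k ≠ π l := fun h => hkl.ne (π.injective h)
    simp only [permWord]
    refine ⟨fun ⟨ha, hb, hc⟩ => ?_, fun ⟨ha, hb, hc⟩ => ?_⟩
    · rcases lt_or_gt_of_ne hne with hd | hd
      · refine h1 (containsPattern_of_lt _ π hij hjk hkl ?_)
        simp [Fin.forall_fin_succ]
        omega
      · refine h2 (containsPattern_of_lt _ π hij hjk hkl ?_)
        simp [Fin.forall_fin_succ]
        omega
    · refine h3 (containsPattern_of_lt _ π hij hjk hkl ?_)
      simp [Fin.forall_fin_succ]
      omega
  · intro h
    have key : ∀ f : Fin 4 → Fin n, StrictMono f → _ := fun f hf =>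
      h (f 0) (f 1) (f 2) (f 3) (hf (by decide)) (hf (by decide)) (hf (by decide))
    refine ⟨?_, ?_, ?_⟩
    · rintro ⟨f, hf, hp⟩
      exact (key f hf).1 ⟨(hp 2 0).2 (by decide), (hp 3 0).2 (by decide), (hp 0 1).2 (by decide)⟩
    · rintro ⟨f, hf, hp⟩
      exact (key f hf).1 ⟨(hp 2 0).2 (by decide), (hp 3 0).2 (by decide), (hp 0 1).2 (by decide)⟩
    · rintro ⟨f, hf, hp⟩
      exact (key f hf).2 ⟨(hp 0 3).2 (by decide), (hp 3 1).2 (by decide), (hp 1 2).2 (by decide)⟩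

lemma ncard_avoiders (n : ℕ) :
    (avoiders {![3, 4, 1, 2], ![3, 4, 2, 1], ![1, 3, 4, 2]} n).ncard =
      descendants n (Fin.elim0 : Fin 0 → ℕ) := by
  classical
  have h := sum_descendants n 0
  rw [zero_add] at h
  rw [avoiders_eq, Set.ncard_eq_toFinset_card', Set.toFinset_ofPred, Finset.card_filter, ← h,
    Fintype.sum_unique, if_pos (show AvoidsTriple _ from fun i => i.elim0)]
  congr 1
  exact Subsingleton.elim _ _

lemma descendants_elim0_succ (d : ℕ) :
    (descendants (d + 1) (Fin.elim0 : Fin 0 → ℕ) : ℚ) = coeff d (weightD []) := by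
  have hs : IsSite (Fin.elim0 : Fin 0 → ℕ) 0 := ⟨fun i => i.elim0, fun i => i.elim0⟩
  have hg : IsPermWord (Fin.elim0 : Fin 0 → ℕ) := ⟨fun i => i.elim0, fun i => i.elim0⟩
  have hB : Avoids231From (prep 0 (Fin.elim0 : Fin 0 → ℕ)) 0 :=
    avoids231From_prep_zero.2 ⟨fun i => i.elim0, noneBelow_zero⟩
  rw [descendants, Finset.sum_range_one, if_pos hs,
    ← coeff_weight d (hg.isPermWord_prep le_rfl), weight, if_pos hB, prep_zero, if_pos rfl]
  rfl

lemma avoidersGF_eq :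
    avoidersGF {![3, 4, 1, 2], ![3, 4, 2, 1], ![1, 3, 4, 2]} = 1 + X * weightD [] := by
  ext n
  rw [avoidersGF, coeff_mk, ncard_avoiders]
  cases n with
  | zero => simp [descendants]
  | succ d => rw [descendants_elim0_succ, map_add, coeff_succ_X_mul]; simp [coeff_one]

end TripleAvoiders

open PowerSeries in
theorem mainTheorem12 :
    avoidersGF {![3, 4, 1, 2], ![3, 4, 2, 1], ![1, 3, 4, 2]} =
      (2 - 11 * X + 13 * X ^ 2 - 6 * X ^ 3
          + (1 - X) * X * (1 - 6 * X + 4 * X ^ 2) * invSqrtOneSubFourX)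
        * (2 * (1 - 6 * X + 8 * X ^ 2 - 4 * X ^ 3))⁻¹ := by
  rw [PowerSeries.eq_mul_inv_iff_mul_eq (by simp [map_ofNat]), avoidersGF_eq]
  exact one_add_X_mul_weightD_nil
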